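/- Let $p$ be a prime. For a group $G$ let $\gamma_1(G)=G$, $\gamma_{i+1}(G)=[\gamma_i(G),G]$ be its lower central series, let $1=Z_0(G)\le Z_1(G)=Z(G)\le Z_2(G)\le\cdots$ be its upper central series, write $K^{m}=\langle g^{m}\mid g\in K\rangle$ for a subgroup $K\le G$, and for $n\ge 1$ put $$\lambda_n(G)=\gamma_1(G)^{p^{n-1}}\,\gamma_2(G)^{p^{n-2}}\cdots\gamma_n(G).$$ For integers $d\ge 2$ and $c\ge 1$, the disposition $p$-group $G_d^c$ is $F/\lambda_{c+1}(F)$, where $F$ is the free group of rank $d$. A group $G$ is called $n$-capable if $G\cong H/Z_n(H)$ for some group $H$. **Corollary.** Let $d\ge 2$ and $c\ge 1$. For every integer $n\ge 0$ the group $G_d^c$ is $n$-capable. More precisely, $Z_n(G_d^{n+c})=\lambda_{c+1}(G_d^{n+c})$ and $$G_d^{c}\;\cong\; G_d^{n+c}/Z_n(G_d^{n+c}).$$ -/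

import Mathlib

/-- The term `γ_i(G)` of the lower central series, indexed so that `γ_1(G) = G` and
`γ_{i+1}(G) = [γ_i(G), G]`. It is only meant for `i ≥ 1`. -/
def lowerGamma (G : Type*) [Group G] (i : ℕ) : Subgroup G :=
  (⊤ : Subgroup G).lowerCentralSeries (i - 1)

/-- The subgroup `K^m = ⟨g ^ m | g ∈ K⟩` generated by the `m`-th powers of elements of `K`. -/
def powerSubgroup {G : Type*} [Group G] (K : Subgroup G) (m : ℕ) : Subgroup G :=
  Subgroup.closure {x | ∃ g ∈ K, g ^ m = x}

/-- `λ_n(G) = γ_1(G)^{p^{n-1}} γ_2(G)^{p^{n-2}} ⋯ γ_n(G)` for `n ≥ 1`. All factors are normal, so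
that their product is their join. -/
def lambdaSeries (p : ℕ) (G : Type*) [Group G] (n : ℕ) : Subgroup G :=
  ⨆ i ∈ Finset.Icc 1 n, powerSubgroup (lowerGamma G i) (p ^ (n - i))

instance lowerGamma_normal (G : Type*) [Group G] (i : ℕ) : (lowerGamma G i).Normal := by
  unfold lowerGamma
  infer_instance

instance powerSubgroup_normal {G : Type*} [Group G] (K : Subgroup G) [hK : K.Normal] (m : ℕ) :
    (powerSubgroup K m).Normal := by
  have h : {x : G | ∃ g ∈ K, g ^ m = x} = Group.conjugatesOfSet {x : G | ∃ g ∈ K, g ^ m = x} := by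
    refine Set.Subset.antisymm Group.subset_conjugatesOfSet ?_
    intro x hx
    obtain ⟨y, ⟨g, hg, rfl⟩, hy⟩ := Group.mem_conjugatesOfSet_iff.mp hx
    obtain ⟨a, rfl⟩ := isConj_iff.mp hy
    exact ⟨a * g * a⁻¹, hK.conj_mem g hg a, conj_pow⟩
  unfold powerSubgroup
  rw [h]
  exact Subgroup.normalClosure_normal

instance lambdaSeries_normal (p : ℕ) (G : Type*) [Group G] (n : ℕ) :
    (lambdaSeries p G n).Normal := by
  unfold lambdaSeries
  infer_instance

/-- The disposition group `G_d^c = F / λ_{c+1}(F)`, with `F` free of rank `d`. -/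
abbrev DispositionGroup (p d c : ℕ) : Type :=
  FreeGroup (Fin d) ⧸ lambdaSeries p (FreeGroup (Fin d)) (c + 1)

/-- A group `G` is `n`-capable if `G ≅ H / Z_n(H)` for some group `H`. -/
def IsNCapable.{u} (n : ℕ) (G : Type u) [Group G] : Prop :=
  ∃ (H : Type u) (_ : Group H), Nonempty (G ≃* H ⧸ Subgroup.upperCentralSeries H n)

/-!
Let `F` be a free group of finite rank. The proof identifies `λ_n(F)` with a dimension subgroup
`D_n`: the elements of `F` whose image under the Magnus representation `x ↦ 1 + x` in the free
associative ring `ℤ⟨X⟩` (suitably truncated) is `1` modulo degree `n`, where `p` and all variables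
have degree one. In other words, the coefficient of the image at a nonempty word of length `l` has
to be divisible by `p ^ (n - l)`.

Once `λ_n(F) = D_n` is known (`lambdaSeries_eq_dimSubgroup`), the centre of `F / λ_{m+1}(F)` is easy
to find. Let `a` be the image of `g`, and let `g` commute with all generators modulo `D_{m+1}`. For a
nonempty word `u` choose a letter `j` other than the last letter of `u`; this is where rank at least
two is needed. The coefficient of `a x_j - x_j a` at the word `x_j u` is minus the coefficient of `a`
at `u`, which is therefore divisible by `p ^ (m - l)` with `l` the length of `u`. So `g` lies in
`D_m` (`mem_dimSubgroup_of_commutator_mem`). By induction the upper central series of `F / λ_N(F)`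
consists of the images of the `λ_i(F)`, and the claims follow from the isomorphism theorems.

The inclusion `λ_n(F) ≤ D_n` is a computation in filtered rings. The converse
(`dimSubgroup_le_powerProduct`) is proved by elimination of generators, for which arbitrary positive
weights of the generators, and arbitrary N-series `S` that respect the weights in place of the lower
central series, have to be admitted. Let `x₀` be a generator of least weight. Modulo `S n`, every
element is a power of `x₀` times an element in the commutators `[y, x₀, …, x₀]` with `y ≠ x₀`
(`exists_eq_zpow_mul_elimHom_mul`). If it lies in `D_n`, then the power of `x₀` does
(`pow_dvd_of_zpow_mul_elimHom_mem`), and the second factor lies in the `n`-th dimension subgroup of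
the free group on symbols for these commutators (`mem_dimSubgroup_of_elimHom_mem`). The last
statement replaces the theorem on free Lie algebras that one would expect here: it holds because `F`
acts on the truncated free ring on these symbols, with `x₀` acting by a unipotent substitution and
`y` by a left multiplication. The new symbols that involve `x₀` have greater weight, so that after
finitely many steps all weights are at least `n`, where nothing is left to prove.
-/

/-! ### Rings filtered with `p` in degree one -/

/-- A descending multiplicative filtration `R = J 0 ≥ J 1 ≥ ⋯` of a ring by additive subgroups
(which are then two-sided ideals) in which the integer `p` has degree one. -/
structure PFiltration (p : ℕ) (R : Type*) [Ring R] where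
  /-- The term of degree `n`. -/
  J : ℕ → AddSubgroup R
  zero_eq : J 0 = ⊤
  anti : Antitone J
  mul_mem : ∀ {i j : ℕ} {a b : R}, a ∈ J i → b ∈ J j → a * b ∈ J (i + j)
  p_mem : (p : R) ∈ J 1

namespace PFiltration

variable {p : ℕ} {R : Type*} [Ring R] (F : PFiltration p R)

lemma mem_zero (a : R) : a ∈ F.J 0 := by
  rw [F.zero_eq]; trivial

lemma mul_mem_left {n : ℕ} (a : R) {b : R} (hb : b ∈ F.J n) : a * b ∈ F.J n := by
  simpa using F.mul_mem (F.mem_zero a) hb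

lemma mul_mem_right {n : ℕ} {a : R} (b : R) (ha : a ∈ F.J n) : a * b ∈ F.J n := by
  simpa using F.mul_mem ha (F.mem_zero b)

lemma pow_mem {i : ℕ} {a : R} (ha : a ∈ F.J i) (k : ℕ) : a ^ k ∈ F.J (k * i) := by
  induction k with
  | zero => simpa using F.mem_zero 1
  | succ k ih => rw [pow_succ, Nat.succ_mul]; exact F.mul_mem ih ha

lemma zsmul_mem {s i k : ℕ} {a : R} (ha : a ∈ F.J (i + s)) {c : ℤ}
    (hc : (p : ℤ) ^ (k - i) ∣ c) : c • a ∈ F.J (k + s) := by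
  obtain ⟨c, rfl⟩ := hc
  have h := F.mul_mem (F.pow_mem F.p_mem (k - i)) ((F.J _).zsmul_mem ha c)
  have h2 : ((p : ℤ) ^ (k - i) * c) • a = (p : R) ^ (k - i) * c • a := by
    rw [mul_smul, zsmul_eq_mul]; push_cast; rfl
  rw [h2]
  exact F.anti (by omega) h

/-- The terms of the filtration as left ideals; they are two-sided. -/
def ideal (n : ℕ) : Ideal R where
  carrier := F.J n
  add_mem' := (F.J n).add_mem
  zero_mem' := (F.J n).zero_mem
  smul_mem' a _ hb := F.mul_mem_left a hb

instance (n : ℕ) : (F.ideal n).IsTwoSided := ⟨fun b ha => F.mul_mem_right b ha⟩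

/-- The image of a filtration under a surjective ring homomorphism. -/
def map {R' : Type*} [Ring R'] (f : R →+* R') (hf : Function.Surjective f) : PFiltration p R' where
  J i := (F.J i).map f.toAddMonoidHom
  zero_eq := by
    rw [F.zero_eq, ← AddMonoidHom.range_eq_map]
    exact AddMonoidHom.range_eq_top.mpr hf
  anti _ _ h := AddSubgroup.map_mono (F.anti h)
  mul_mem := by
    rintro i j _ _ ⟨a, ha, rfl⟩ ⟨b, hb, rfl⟩
    exact ⟨a * b, F.mul_mem ha hb, map_mul f a b⟩
  p_mem := ⟨p, F.p_mem, map_natCast f p⟩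

/-- The congruence subgroup of units that are `1` modulo the `n`-th term. -/
def units (n : ℕ) : Subgroup Rˣ where
  carrier := {u | (u : R) - 1 ∈ F.J n}
  one_mem' := by simp
  mul_mem' := by
    intro u v hu hv
    have : ((u * v : Rˣ) : R) - 1 = ((u : R) - 1) * v + (v - 1) := by push_cast; noncomm_ring
    rw [Set.mem_ofPred_eq, this]
    exact add_mem (F.mul_mem_right _ hu) hv
  inv_mem' := by
    intro u hu
    have : ((u⁻¹ : Rˣ) : R) - 1 = -(((u⁻¹ : Rˣ) : R) * (u - 1)) := by
      rw [mul_sub, Units.inv_mul]; noncomm_ring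
    rw [Set.mem_ofPred_eq, this]
    exact neg_mem (F.mul_mem_left _ hu)

@[simp] lemma mem_units {n : ℕ} {u : Rˣ} : u ∈ F.units n ↔ (u : R) - 1 ∈ F.J n := Iff.rfl

lemma commutator_units_le (i j : ℕ) : ⁅F.units i, F.units j⁆ ≤ F.units (i + j) := by
  rw [Subgroup.commutator_le]
  intro u hu v hv
  have h : ((u * v * u⁻¹ * v⁻¹ : Rˣ) : R) - 1 =
      ((u - 1) * (v - 1) - (v - 1) * (u - 1)) * ((u⁻¹ : Rˣ) * (v⁻¹ : Rˣ) : R) := by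
    have h1 : ((u - 1) * (v - 1) - (v - 1) * (u - 1) : R) = u * v - v * u := by noncomm_ring
    rw [h1, sub_mul]
    push_cast
    congr 1
    · noncomm_ring
    · rw [mul_assoc, ← mul_assoc (u : R), Units.mul_inv, one_mul, Units.mul_inv]
  rw [commutatorElement_def, mem_units, h]
  refine F.mul_mem_right _ (sub_mem (F.mul_mem hu hv) ?_)
  rw [add_comm]
  exact F.mul_mem hv hu

/-- In `(1 + a) ^ p - 1` every term but `a ^ p` is a multiple of `p a`, and `a ^ p` lies deeper
still. -/
lemma pow_prime_mem_units (hp : p.Prime) {i : ℕ} (hi : 1 ≤ i) {u : Rˣ} (hu : u ∈ F.units i) :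
    u ^ p ∈ F.units (i + 1) := by
  set a : R := u - 1 with ha
  have hu' : (u : R) = a + 1 := by simp [ha]
  rw [mem_units, Units.val_pow_eq_pow_val, hu', (Commute.one_right a).add_pow,
    Finset.sum_range_succ', add_sub_assoc]
  simp only [one_pow, mul_one, pow_zero, Nat.choose_zero_right, Nat.cast_one, sub_self, add_zero]
  refine sum_mem fun k hk => ?_
  have hk' := Finset.mem_range.mp hk
  rcases eq_or_ne (k + 1) p with h | h
  · rw [h, Nat.choose_self, Nat.cast_one, mul_one]
    refine F.anti ?_ (F.pow_mem hu p)
    nlinarith [hp.two_le]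
  · obtain ⟨c, hc⟩ := hp.dvd_choose_self k.succ_ne_zero (show k + 1 < p by omega)
    rw [hc, Nat.cast_mul, ← mul_assoc]
    refine F.mul_mem_right _ (F.mul_mem ?_ F.p_mem)
    rw [pow_succ]
    exact F.mul_mem_left _ hu

lemma pow_prime_pow_mem_units (hp : p.Prime) {i : ℕ} (hi : 1 ≤ i) {u : Rˣ} (hu : u ∈ F.units i)
    (k : ℕ) : u ^ p ^ k ∈ F.units (i + k) := by
  induction k with
  | zero => simpa using hu
  | succ k ih =>
    rw [pow_succ, pow_mul]
    exact F.pow_prime_mem_units hp (show 1 ≤ i + k by omega) ih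

end PFiltration

/-! ### N-series and dimension subgroups -/

/-- A descending series `G = S 0 ≥ S 1 ≥ ⋯` of subgroups with `[S i, S j] ≤ S (i + j)`. -/
structure IsNSeries {G : Type*} [Group G] (S : ℕ → Subgroup G) : Prop where
  zero_eq : S 0 = ⊤
  anti : Antitone S
  commutator_le : ∀ i j, ⁅S i, S j⁆ ≤ S (i + j)

namespace IsNSeries

variable {G : Type*} [Group G] {S T : ℕ → Subgroup G}

lemma normal (hS : IsNSeries S) (n : ℕ) : (S n).Normal := by
  refine ⟨fun a ha g => ?_⟩
  have h := hS.commutator_le 0 n (Subgroup.commutator_mem_commutator (g₁ := g)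
    (by rw [hS.zero_eq]; trivial) ha)
  rw [zero_add] at h
  simpa [commutatorElement_def] using mul_mem h ha

lemma inf (hS : IsNSeries S) (hT : IsNSeries T) : IsNSeries (fun n => S n ⊓ T n) where
  zero_eq := by rw [hS.zero_eq, hT.zero_eq, inf_top_eq]
  anti _ _ h := inf_le_inf (hS.anti h) (hT.anti h)
  commutator_le i j := le_inf
    ((Subgroup.commutator_mono inf_le_left inf_le_left).trans (hS.commutator_le i j))
    ((Subgroup.commutator_mono inf_le_right inf_le_right).trans (hT.commutator_le i j))

lemma comap {H : Type*} [Group H] (hS : IsNSeries S) (f : H →* G) :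
    IsNSeries (fun n => (S n).comap f) where
  zero_eq := by rw [hS.zero_eq, Subgroup.comap_top]
  anti _ _ h := Subgroup.comap_mono (hS.anti h)
  commutator_le i j := by
    rw [← Subgroup.map_le_iff_le_comap, Subgroup.map_commutator]
    exact (Subgroup.commutator_mono (Subgroup.map_comap_le _ _)
      (Subgroup.map_comap_le _ _)).trans (hS.commutator_le i j)

end IsNSeries

/-- The three subgroups lemma modulo a normal subgroup. -/
lemma commutator_commutator_le_of_rotate {G : Type*} [Group G] {H₁ H₂ H₃ N : Subgroup G}
    [N.Normal] (h1 : ⁅⁅H₂, H₃⁆, H₁⁆ ≤ N) (h2 : ⁅⁅H₃, H₁⁆, H₂⁆ ≤ N) : ⁅⁅H₁, H₂⁆, H₃⁆ ≤ N := by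
  rw [← QuotientGroup.ker_mk' N, ← Subgroup.map_eq_bot_iff] at h1 h2 ⊢
  simp only [Subgroup.map_commutator] at h1 h2 ⊢
  exact Subgroup.commutator_commutator_eq_bot_of_rotate h1 h2

lemma isNSeries_lowerGamma (G : Type*) [Group G] : IsNSeries (lowerGamma G) := by
  have key : ∀ i j, ⁅(⊤ : Subgroup G).lowerCentralSeries i, (⊤ : Subgroup G).lowerCentralSeries j⁆ ≤
      (⊤ : Subgroup G).lowerCentralSeries (i + j + 1) := by
    intro i
    induction i with
    | zero =>
      intro j
      rw [Subgroup.commutator_comm, Subgroup.lowerCentralSeries_zero, zero_add,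
        Subgroup.lowerCentralSeries_succ]
    | succ i ih =>
      intro j
      rw [Subgroup.lowerCentralSeries_succ]
      refine commutator_commutator_le_of_rotate ?_ ?_
      · rw [Subgroup.commutator_comm ⊤, ← Subgroup.lowerCentralSeries_succ,
          Subgroup.commutator_comm]
        exact (ih (j + 1)).trans (Subgroup.lowerCentralSeries_antitone _ (by omega))
      · rw [Subgroup.commutator_comm (Subgroup.lowerCentralSeries _ _)]
        refine (Subgroup.commutator_mono (ih j) le_rfl).trans ?_
        rw [← Subgroup.lowerCentralSeries_succ]
        exact Subgroup.lowerCentralSeries_antitone _ (by omega)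
  refine ⟨rfl, fun i j h => Subgroup.lowerCentralSeries_antitone _ (by omega), fun i j => ?_⟩
  rcases Nat.eq_zero_or_pos i with rfl | hi
  · rw [zero_add]; exact Subgroup.commutator_le_right _ _
  rcases Nat.eq_zero_or_pos j with rfl | hj
  · exact Subgroup.commutator_le_left _ _
  exact (key (i - 1) (j - 1)).trans (Subgroup.lowerCentralSeries_antitone _ (by omega))

/-- The product `∏ S_i ^ (p ^ (n - i))` over `1 ≤ i ≤ n`, which for the lower central series is
the subgroup `λ_n`. -/
def powerProduct {G : Type*} [Group G] (p : ℕ) (S : ℕ → Subgroup G) (n : ℕ) : Subgroup G :=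
  ⨆ i ∈ Finset.Icc 1 n, powerSubgroup (S i) (p ^ (n - i))

section powerProduct

variable {G : Type*} [Group G] {p n : ℕ} {S : ℕ → Subgroup G}

lemma pow_mem_powerProduct {i : ℕ} (hi : 1 ≤ i) (hin : i ≤ n) {g : G} (hg : g ∈ S i) :
    g ^ p ^ (n - i) ∈ powerProduct p S n :=
  le_iSup₂_of_le (f := fun i (_ : i ∈ Finset.Icc 1 n) => powerSubgroup (S i) (p ^ (n - i))) i
    (Finset.mem_Icc.mpr ⟨hi, hin⟩) le_rfl (Subgroup.subset_closure ⟨g, hg, rfl⟩)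

lemma le_powerProduct (hn : 1 ≤ n) : S n ≤ powerProduct p S n := fun g hg => by
  simpa using pow_mem_powerProduct (p := p) hn le_rfl hg

lemma powerProduct_le {K : Subgroup G}
    (h : ∀ i, 1 ≤ i → i ≤ n → ∀ g ∈ S i, g ^ p ^ (n - i) ∈ K) : powerProduct p S n ≤ K := by
  refine iSup₂_le fun i hi => ?_
  obtain ⟨h1, h2⟩ := Finset.mem_Icc.mp hi
  refine (Subgroup.closure_le _).mpr ?_
  rintro _ ⟨g, hg, rfl⟩
  exact h i h1 h2 g hg

lemma lambdaSeries_eq_powerProduct : lambdaSeries p G n = powerProduct p (lowerGamma G) n := rfl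

end powerProduct

/-- The `n`-th dimension subgroup of the free group on `X` relative to `p` and to the weights `w`:
the elements that are `1` modulo degree `n` under every homomorphism into the unit group of a
`p`-filtered ring that maps each generator `x` to an element that is `1` modulo degree `w x`. -/
def dimSubgroup {X : Type} (p : ℕ) (w : X → ℕ) (n : ℕ) : Subgroup (FreeGroup X) where
  carrier := {g | ∀ (R : Type) [Ring R] (F : PFiltration p R) (ρ : FreeGroup X →* Rˣ),
    (∀ x, ρ (FreeGroup.of x) ∈ F.units (w x)) → ρ g ∈ F.units n}
  one_mem' R _ F ρ _ := by rw [map_one]; exact one_mem _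
  mul_mem' ha hb R _ F ρ h := by rw [map_mul]; exact mul_mem (ha R F ρ h) (hb R F ρ h)
  inv_mem' ha R _ F ρ h := by rw [map_inv]; exact inv_mem (ha R F ρ h)

section dimSubgroup

variable {X : Type} {p : ℕ} {w : X → ℕ}

lemma of_mem_dimSubgroup (x : X) : FreeGroup.of x ∈ dimSubgroup p w (w x) :=
  fun _ _ _ _ h => h x

lemma isNSeries_dimSubgroup : IsNSeries (dimSubgroup p w) where
  zero_eq := top_le_iff.mp fun g _ R _ F ρ _ => F.mem_zero _
  anti i j h g hg R _ F ρ hρ := F.anti h (hg R F ρ hρ)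
  commutator_le i j := by
    rw [Subgroup.commutator_le]
    intro a ha b hb R _ F ρ hρ
    rw [map_commutatorElement]
    exact F.commutator_units_le i j
      (Subgroup.commutator_mem_commutator (ha R F ρ hρ) (hb R F ρ hρ))

lemma pow_mem_dimSubgroup (hp : p.Prime) {i : ℕ} (hi : 1 ≤ i) {g : FreeGroup X}
    (hg : g ∈ dimSubgroup p w i) (k : ℕ) : g ^ p ^ k ∈ dimSubgroup p w (i + k) := by
  intro R _ F ρ hρ
  rw [map_pow]
  exact F.pow_prime_pow_mem_units hp hi (hg R F ρ hρ) k

lemma powerProduct_le_dimSubgroup (hp : p.Prime) (n : ℕ) {S : ℕ → Subgroup (FreeGroup X)}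
    (hS : ∀ i, S i ≤ dimSubgroup p w i) : powerProduct p S n ≤ dimSubgroup p w n := by
  refine powerProduct_le fun i hi hin g hg => ?_
  have := pow_mem_dimSubgroup hp hi (hS i hg) (n - i)
  rwa [Nat.add_sub_cancel' hin] at this

lemma lowerGamma_le_dimSubgroup (i : ℕ) :
    lowerGamma (FreeGroup X) i ≤ dimSubgroup p (fun _ : X => 1) i := by
  have hD : IsNSeries (dimSubgroup p (fun _ : X => 1)) := isNSeries_dimSubgroup
  have h1 : dimSubgroup p (fun _ : X => 1) 1 = ⊤ := by
    rw [← top_le_iff, ← FreeGroup.closure_range_of, Subgroup.closure_le]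
    rintro _ ⟨x, rfl⟩
    exact of_mem_dimSubgroup (w := fun _ : X => 1) x
  have key : ∀ k, (⊤ : Subgroup (FreeGroup X)).lowerCentralSeries k ≤
      dimSubgroup p (fun _ : X => 1) (k + 1) := by
    intro k
    induction k with
    | zero => rw [h1]; exact le_top
    | succ k ih =>
      rw [Subgroup.lowerCentralSeries_succ]
      exact (Subgroup.commutator_mono ih h1.ge).trans (hD.commutator_le _ _)
  rcases Nat.eq_zero_or_pos i with rfl | hi
  · rw [hD.zero_eq]; exact le_top
  exact (key (i - 1)).trans (hD.anti (by omega))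

lemma lambdaSeries_le_dimSubgroup (hp : p.Prime) (n : ℕ) :
    lambdaSeries p (FreeGroup X) n ≤ dimSubgroup p (fun _ : X => 1) n :=
  powerProduct_le_dimSubgroup hp n lowerGamma_le_dimSubgroup

end dimSubgroup

/-! ### The universal filtered ring -/

section Magnus

variable {X : Type}

/-- The weight of a word, when the letter `x` has weight `w x`. -/
def wordWeight (w : X → ℕ) (u : FreeMonoid X) : ℕ :=
  (u.toList.map w).sum

@[simp] lemma wordWeight_one (w : X → ℕ) : wordWeight w 1 = 0 := rfl

@[simp] lemma wordWeight_of (w : X → ℕ) (x : X) : wordWeight w (FreeMonoid.of x) = w x := by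
  simp [wordWeight]

@[simp] lemma wordWeight_mul (w : X → ℕ) (u v : FreeMonoid X) :
    wordWeight w (u * v) = wordWeight w u + wordWeight w v := by
  simp [wordWeight]

/-- The free associative ring on `X`, with `ℤ`-basis the words in `X`. -/
abbrev WordRing (X : Type) : Type := MonoidAlgebra ℤ (FreeMonoid X)

/-- The variable of the free associative ring that corresponds to `x`. -/
noncomputable def WordRing.var (x : X) : WordRing X := MonoidAlgebra.single (FreeMonoid.of x) 1

/-- The ring homomorphism out of the free associative ring with prescribed images of the
variables. -/
noncomputable def WordRing.lift {R : Type*} [Ring R] (f : X → R) : WordRing X →+* R :=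
  (MonoidAlgebra.lift ℤ R (FreeMonoid X) (FreeMonoid.lift f)).toRingHom

lemma WordRing.lift_single {R : Type*} [Ring R] (f : X → R) (u : FreeMonoid X) (c : ℤ) :
    WordRing.lift f (MonoidAlgebra.single u c) = c • FreeMonoid.lift f u :=
  MonoidAlgebra.lift_single _ _ _

@[simp] lemma WordRing.lift_var {R : Type*} [Ring R] (f : X → R) (x : X) :
    WordRing.lift f (WordRing.var x) = f x := by
  simp [WordRing.var, WordRing.lift_single]

/-- The filtration of the free associative ring in which `p` has degree one and the letter `x` has
degree `w x`: the coefficient of a word `u` in an element of degree `n` is divisible by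
`p ^ (n - wt u)`, where the subtraction is truncated. -/
def magnusFiltration (p : ℕ) (w : X → ℕ) : PFiltration p (WordRing X) where
  J n :=
    { carrier := {a | ∀ u, (p : ℤ) ^ (n - wordWeight w u) ∣ a.coeff u}
      zero_mem' := fun u => by simp
      add_mem' := fun ha hb u => by
        rw [MonoidAlgebra.coeff_add]; exact dvd_add (ha u) (hb u)
      neg_mem' := fun ha u => by
        rw [MonoidAlgebra.coeff_neg]; exact (dvd_neg).mpr (ha u) }
  zero_eq := top_le_iff.mp fun a _ u => by simp
  anti i j h a ha u := (pow_dvd_pow _ (by omega)).trans (ha u)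
  mul_mem := by
    classical
    intro i j a b ha hb u
    rw [MonoidAlgebra.coeff_mul]
    refine Finset.dvd_sum fun v _ => Finset.dvd_sum fun v' _ => ?_
    dsimp only
    split_ifs with h
    · refine (pow_dvd_pow _ ?_).trans ((pow_add (p : ℤ) _ _).dvd.trans (mul_dvd_mul (ha v) (hb v')))
      rw [← h, wordWeight_mul]
      omega
    · exact dvd_zero _
  p_mem := by
    classical
    intro u
    rw [MonoidAlgebra.coeff_natCast, Finsupp.single_apply]
    split_ifs with h
    · simp [← h]
    · exact dvd_zero _

variable {p : ℕ} {w : X → ℕ}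

lemma mem_magnusFiltration {n : ℕ} {a : WordRing X} :
    a ∈ (magnusFiltration p w).J n ↔ ∀ u, (p : ℤ) ^ (n - wordWeight w u) ∣ a.coeff u := Iff.rfl

lemma var_mem_magnusFiltration (x : X) : WordRing.var x ∈ (magnusFiltration p w).J (w x) := by
  classical
  intro u
  rw [WordRing.var, MonoidAlgebra.coeff_single, Finsupp.single_apply]
  split_ifs with h
  · simp [← h]
  · exact dvd_zero _

/-- An additive map that raises the degree of every word by `s` raises all degrees by `s`. -/
lemma map_mem_of_magnusFiltration {R : Type*} [Ring R] (F : PFiltration p R) {s : ℕ}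
    (φ : WordRing X →+ R)
    (h : ∀ u, φ (MonoidAlgebra.single u 1) ∈ F.J (wordWeight w u + s)) {n : ℕ} {a : WordRing X}
    (ha : a ∈ (magnusFiltration p w).J n) : φ a ∈ F.J (n + s) := by
  rw [← MonoidAlgebra.sum_coeff_single a, Finsupp.sum, map_sum]
  refine sum_mem fun u _ => ?_
  have h1 : MonoidAlgebra.single u (a.coeff u) =
      a.coeff u • (MonoidAlgebra.single u 1 : WordRing X) := by
    rw [MonoidAlgebra.smul_single, smul_eq_mul, mul_one]
  rw [h1, map_zsmul]
  exact F.zsmul_mem (h u) (ha u)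

lemma word_mem {R : Type*} [Ring R] (F : PFiltration p R) {f : X → R}
    (hf : ∀ x, f x ∈ F.J (w x)) (u : FreeMonoid X) :
    FreeMonoid.lift f u ∈ F.J (wordWeight w u) := by
  induction u with
  | one => simpa using F.mem_zero 1
  | of x => simpa using hf x
  | mul u v hu hv => rw [map_mul, wordWeight_mul]; exact F.mul_mem hu hv

lemma lift_mem {R : Type*} [Ring R] (F : PFiltration p R) {f : X → R}
    (hf : ∀ x, f x ∈ F.J (w x)) {n : ℕ} {a : WordRing X}
    (ha : a ∈ (magnusFiltration p w).J n) : WordRing.lift f a ∈ F.J n := by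
  refine map_mem_of_magnusFiltration F (s := 0) (WordRing.lift f).toAddMonoidHom (fun u => ?_) ha
  have := word_mem F hf u
  simpa [WordRing.lift_single] using this

/-- If `f x` is congruent to `x` in degree `w x + s` for every letter, then the substitution
`x ↦ f x` moves elements only by terms of degree at least `s` higher. -/
lemma lift_sub_self_mem {f : X → WordRing X} {s : ℕ}
    (hf : ∀ x, f x - WordRing.var x ∈ (magnusFiltration p w).J (w x + s)) {n : ℕ}
    {a : WordRing X} (ha : a ∈ (magnusFiltration p w).J n) :
    WordRing.lift f a - a ∈ (magnusFiltration p w).J (n + s) := by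
  set F := magnusFiltration p w
  have hf' : ∀ x, f x ∈ F.J (w x) := fun x => by
    simpa using add_mem (F.anti (Nat.le_add_right _ s) (hf x)) (var_mem_magnusFiltration x)
  refine map_mem_of_magnusFiltration F (s := s)
    ((WordRing.lift f).toAddMonoidHom - AddMonoidHom.id _) (fun u => ?_) ha
  have hvar : ∀ u : FreeMonoid X, FreeMonoid.lift WordRing.var u =
      (MonoidAlgebra.single u 1 : WordRing X) := by
    intro u
    have : FreeMonoid.lift WordRing.var = MonoidAlgebra.of ℤ (FreeMonoid X) := by
      ext1 x; simp [WordRing.var]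
    rw [this]; rfl
  have hu : FreeMonoid.lift f u - FreeMonoid.lift WordRing.var u ∈ F.J (wordWeight w u + s) := by
    induction u with
    | one => simp
    | of x => simpa using hf x
    | mul u v hu hv =>
      have h : FreeMonoid.lift f (u * v) - FreeMonoid.lift WordRing.var (u * v) =
          (FreeMonoid.lift f u - FreeMonoid.lift WordRing.var u) * FreeMonoid.lift f v +
          FreeMonoid.lift WordRing.var u *
            (FreeMonoid.lift f v - FreeMonoid.lift WordRing.var v) := by
        rw [map_mul, map_mul]; noncomm_ring
      rw [h, wordWeight_mul]
      refine add_mem (F.anti ?_ (F.mul_mem hu (word_mem F hf' v)))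
        (F.anti ?_ (F.mul_mem (word_mem F var_mem_magnusFiltration u) hv)) <;> omega
  rw [hvar] at hu
  simpa [WordRing.lift_single] using hu

/-- The free associative ring truncated in degree `n`. -/
abbrev MagnusRing (p : ℕ) (w : X → ℕ) (n : ℕ) : Type :=
  WordRing X ⧸ (magnusFiltration p w).ideal n

/-- The filtration of the truncated ring that the free associative ring induces. -/
noncomputable def truncFiltration (p : ℕ) (w : X → ℕ) (n : ℕ) :
    PFiltration p (MagnusRing p w n) :=
  (magnusFiltration p w).map (Ideal.Quotient.mk _) Ideal.Quotient.mk_surjective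

lemma truncFiltration_eq_bot {n : ℕ} {a : MagnusRing p w n}
    (ha : a ∈ (truncFiltration p w n).J n) : a = 0 := by
  obtain ⟨b, hb, rfl⟩ := ha
  exact Ideal.Quotient.eq_zero_iff_mem.mpr hb

/-- The image of a variable in the truncated ring. -/
noncomputable def MagnusRing.var (p : ℕ) (w : X → ℕ) (n : ℕ) (x : X) : MagnusRing p w n :=
  Ideal.Quotient.mk _ (WordRing.var x)

lemma MagnusRing.var_mem (n : ℕ) (x : X) :
    MagnusRing.var p w n x ∈ (truncFiltration p w n).J (w x) :=
  ⟨_, var_mem_magnusFiltration x, rfl⟩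

/-- An element of positive degree in a filtered ring whose filtration vanishes in degree `n` is
nilpotent. -/
lemma PFiltration.isNilpotent {R : Type*} [Ring R] (F : PFiltration p R) {n i : ℕ}
    (hF : ∀ a ∈ F.J n, a = 0) (hi : 1 ≤ i) {a : R} (ha : a ∈ F.J i) : IsNilpotent a :=
  ⟨n, hF _ (F.anti (Nat.le_mul_of_pos_right n hi) (F.pow_mem ha n))⟩

lemma MagnusRing.isUnit_one_add_var (hw : ∀ x, 1 ≤ w x) (n : ℕ) (x : X) :
    IsUnit (1 + MagnusRing.var p w n x) :=
  ((truncFiltration p w n).isNilpotent (fun _ => truncFiltration_eq_bot) (hw x)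
    (MagnusRing.var_mem n x)).isUnit_one_add

/-- The Magnus representation `x ↦ 1 + x` of the free group in the truncated ring. -/
noncomputable def magnusHom (p : ℕ) {w : X → ℕ} (hw : ∀ x, 1 ≤ w x) (n : ℕ) :
    FreeGroup X →* (MagnusRing p w n)ˣ :=
  FreeGroup.lift fun x => (MagnusRing.isUnit_one_add_var hw n x).unit

@[simp] lemma magnusHom_of (hw : ∀ x, 1 ≤ w x) (n : ℕ) (x : X) :
    ((magnusHom p hw n (FreeGroup.of x) : (MagnusRing p w n)ˣ) : MagnusRing p w n) =
      1 + MagnusRing.var p w n x := by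
  simp [magnusHom]

lemma magnusHom_of_mem_units (hw : ∀ x, 1 ≤ w x) (n : ℕ) (x : X) :
    magnusHom p hw n (FreeGroup.of x) ∈ (truncFiltration p w n).units (w x) := by
  rw [PFiltration.mem_units, magnusHom_of, add_sub_cancel_left]
  exact MagnusRing.var_mem n x

/-- The Magnus representation is universal, hence it detects the dimension subgroups. -/
lemma mem_dimSubgroup_iff_magnusHom_mem (hw : ∀ x, 1 ≤ w x) {m n : ℕ} (hmn : m ≤ n)
    {g : FreeGroup X} :
    g ∈ dimSubgroup p w m ↔ magnusHom p hw n g ∈ (truncFiltration p w n).units m := by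
  refine ⟨fun hg => hg _ _ _ (magnusHom_of_mem_units hw n), fun hg R _ F ρ hρ => ?_⟩
  let f : X → R := fun x => ρ (FreeGroup.of x) - 1
  let θ : MagnusRing p w n →+* R ⧸ F.ideal m :=
    Ideal.Quotient.lift _ ((Ideal.Quotient.mk (F.ideal m)).comp (WordRing.lift f)) fun a ha =>
      Ideal.Quotient.eq_zero_iff_mem.mpr (F.anti hmn (lift_mem F hρ ha))
  have key : (Units.map (θ : MagnusRing p w n →* R ⧸ F.ideal m)).comp (magnusHom p hw n) =
      (Units.map (Ideal.Quotient.mk (F.ideal m) : R →* R ⧸ F.ideal m)).comp ρ := by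
    refine FreeGroup.ext_hom _ _ fun x => Units.ext ?_
    have h1 : θ (MagnusRing.var p w n x) = Ideal.Quotient.mk (F.ideal m) (f x) := by
      simp [θ, MagnusRing.var]
    simp [h1, f]
  have h3 := congrArg Units.val (DFunLike.congr_fun key g)
  simp only [MonoidHom.comp_apply, Units.coe_map] at h3
  obtain ⟨b, hb, hb'⟩ := hg
  have h4 : θ ((magnusHom p hw n g : MagnusRing p w n) - 1) = 0 := by
    rw [← hb']
    exact Ideal.Quotient.eq_zero_iff_mem.mpr (lift_mem F hρ hb)
  rw [map_sub, map_one, sub_eq_zero] at h4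
  exact (Ideal.Quotient.mk_eq_one_iff_sub_mem _).mp (h3.symm.trans h4)

end Magnus

/-! ### Filtered endomorphisms -/

section FilteredEnd

variable {p : ℕ} {R : Type*} [Ring R] (F : PFiltration p R)

/-- The ring of additive endomorphisms of a filtered ring that preserve the filtration. -/
def filteredEnd : Subring (Module.End ℤ R) where
  carrier := {f | ∀ j, ∀ a ∈ F.J j, f a ∈ F.J j}
  one_mem' := fun _ _ ha => ha
  zero_mem' := fun j _ _ => (F.J j).zero_mem
  add_mem' hf hg j a ha := (F.J j).add_mem (hf j a ha) (hg j a ha)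
  mul_mem' hf hg j a ha := hf j _ (hg j a ha)
  neg_mem' hf j a ha := (F.J j).neg_mem (hf j a ha)

/-- Endomorphisms of degree `i` are those that raise degrees by `i`. -/
def endFiltration : PFiltration p (filteredEnd F) where
  J i :=
    { carrier := {f | ∀ j, ∀ a ∈ F.J j, f.1 a ∈ F.J (i + j)}
      zero_mem' := fun j _ _ => (F.J _).zero_mem
      add_mem' := fun hf hg j a ha => (F.J _).add_mem (hf j a ha) (hg j a ha)
      neg_mem' := fun hf j a ha => (F.J _).neg_mem (hf j a ha) }
  zero_eq := top_le_iff.mp fun f _ j a ha => by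
    rw [zero_add]; exact f.2 j a ha
  anti _ _ h f hf j a ha := F.anti (by omega) (hf j a ha)
  mul_mem := by
    intro i i' f g hf hg j a ha
    rw [add_assoc]
    exact hf _ _ (hg j a ha)
  p_mem j a ha := by
    have h : ((p : filteredEnd F) : Module.End ℤ R) a = (p : R) * a := by
      simp [Module.End.natCast_apply]
    rw [h]
    exact F.mul_mem F.p_mem ha

/-- Left multiplication as a ring homomorphism into the filtered endomorphisms. -/
def filteredLmul : R →+* filteredEnd F :=
  (Algebra.lmul ℤ R).toRingHom.codRestrict _ fun a _ _ hb => F.mul_mem_left a hb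

variable {F}

lemma filteredLmul_mem {i : ℕ} {a : R} (ha : a ∈ F.J i) :
    filteredLmul F a ∈ (endFiltration F).J i := fun _ _ hb => F.mul_mem ha hb

lemma eq_zero_of_mem_endFiltration {n : ℕ} (hF : ∀ a ∈ F.J n, a = 0) {f : filteredEnd F}
    (hf : f ∈ (endFiltration F).J n) : f = 0 :=
  Subtype.ext <| LinearMap.ext fun a => hF _ (hf 0 a (F.mem_zero a))

/-- An endomorphism that is unipotent for a filtration of finite length is invertible. -/
lemma exists_unit_of_sub_mem {n s : ℕ} (hs : 1 ≤ s) (hF : ∀ a ∈ F.J n, a = 0)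
    (τ : R →+* R) (hτ : ∀ j, ∀ a ∈ F.J j, τ a - a ∈ F.J (j + s)) :
    ∃ T : (filteredEnd F)ˣ, (∀ a, (T : filteredEnd F).1 a = τ a) ∧
      T ∈ (endFiltration F).units s := by
  let δ : filteredEnd F := ⟨τ.toAddMonoidHom.toIntLinearMap - 1, fun j a ha =>
    F.anti (Nat.le_add_right _ _) (hτ j a ha)⟩
  have hδ : δ ∈ (endFiltration F).J s := fun j a ha => by
    rw [add_comm]; exact hτ j a ha
  have hu : IsUnit (1 + δ) := ((endFiltration F).isNilpotent
    (fun _ => eq_zero_of_mem_endFiltration hF) hs hδ).isUnit_one_add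
  refine ⟨hu.unit, fun a => ?_, ?_⟩
  · change a + (τ a - a) = τ a
    abel
  · rw [PFiltration.mem_units, IsUnit.unit_spec, add_sub_cancel_left]
    exact hδ

end FilteredEnd

/-! ### Elimination of a generator -/

section Elimination

/-- The commutators `[b, a, …, a]` with `k` entries `a`, where `[b, a] = b⁻¹ a b a⁻¹`. -/
def iterComm {G : Type*} [Group G] (a b : G) : ℕ → G
  | 0 => b
  | k + 1 => (iterComm a b k)⁻¹ * (a * iterComm a b k * a⁻¹)

lemma iterComm_mul_succ {G : Type*} [Group G] (a b : G) (k : ℕ) :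
    iterComm a b k * iterComm a b (k + 1) = a * iterComm a b k * a⁻¹ := by
  rw [iterComm, mul_inv_cancel_left]

lemma map_iterComm {G H : Type*} [Group G] [Group H] (f : G →* H) (a b : G) (k : ℕ) :
    f (iterComm a b k) = iterComm (f a) (f b) k := by
  induction k with
  | zero => rfl
  | succ k ih => simp [iterComm, ih]

lemma iterComm_mem {G : Type*} [Group G] {S : ℕ → Subgroup G} (hS : IsNSeries S) {i j : ℕ}
    {a b : G} (ha : a ∈ S i) (hb : b ∈ S j) (k : ℕ) : iterComm a b k ∈ S (j + k * i) := by
  induction k with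
  | zero => rw [zero_mul, add_zero]; exact hb
  | succ k ih =>
    have h := hS.commutator_le _ _ (Subgroup.commutator_mem_commutator (inv_mem ih) ha)
    rw [commutatorElement_def, inv_inv] at h
    have e : iterComm a b (k + 1) = (iterComm a b k)⁻¹ * a * iterComm a b k * a⁻¹ := by
      rw [iterComm]; group
    rw [e]
    convert h using 2
    ring

variable {X : Type} (x₀ : X)

/-- The generators that remain when `x₀` is eliminated: `(y, k)` stands for the commutator
`[y, x₀, …, x₀]` with `k` entries `x₀`. -/
abbrev ElimIndex : Type := {y : X // y ≠ x₀} × ℕ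

/-- The weight of the commutator `[y, x₀, …, x₀]`. -/
def elimWeight (w : X → ℕ) (z : ElimIndex x₀) : ℕ := w z.1 + z.2 * w x₀

/-- The homomorphism that evaluates the remaining generators in the free group on `X`. -/
def elimHom : FreeGroup (ElimIndex x₀) →* FreeGroup X :=
  FreeGroup.lift fun z => iterComm (FreeGroup.of x₀) (FreeGroup.of z.1.1) z.2

lemma elimHom_of (z : ElimIndex x₀) : elimHom x₀ (FreeGroup.of z) =
    iterComm (FreeGroup.of x₀) (FreeGroup.of z.1.1) z.2 := by
  simp [elimHom]

variable {x₀} {p : ℕ} {w : X → ℕ}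

lemma one_le_elimWeight (hw : ∀ x, 1 ≤ w x) (z : ElimIndex x₀) : 1 ≤ elimWeight x₀ w z :=
  (hw _).trans (Nat.le_add_right _ _)

/-- The substitution `y_k ↦ y_k + y_{k+1} + y_k y_{k+1}`, that is
`1 + y_k ↦ (1 + y_k) (1 + y_{k+1})`, describes conjugation by `x₀`. On the truncated free ring on
the remaining generators it is unipotent. Letting `x₀` act by it and `y` by left multiplication
with `1 + y_0`, one obtains an action of the free group on `X` in which `[y, x₀, …, x₀]` is left
multiplication by `1 + y_k`. -/
lemma mem_dimSubgroup_of_elimHom_mem (hw : ∀ x, 1 ≤ w x) {n : ℕ}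
    {h : FreeGroup (ElimIndex x₀)} (hh : elimHom x₀ h ∈ dimSubgroup p w n) :
    h ∈ dimSubgroup p (elimWeight x₀ w) n := by
  classical
  set w' := elimWeight x₀ w with hw'
  have hw1 : ∀ z, 1 ≤ w' z := one_le_elimWeight hw
  set M := magnusFiltration p w'
  set F := truncFiltration p w' n
  have hF : ∀ a ∈ F.J n, a = 0 := fun _ => truncFiltration_eq_bot
  let V : ElimIndex x₀ → WordRing (ElimIndex x₀) := WordRing.var
  let f : ElimIndex x₀ → WordRing (ElimIndex x₀) := fun z =>
    V z + V (z.1, z.2 + 1) + V z * V (z.1, z.2 + 1)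
  have hf : ∀ z, f z - V z ∈ M.J (w' z + w x₀) := by
    intro z
    have hV : V (z.1, z.2 + 1) ∈ M.J (w' z + w x₀) := by
      have := var_mem_magnusFiltration (p := p) (w := w') (z.1, z.2 + 1)
      convert this using 2
      simp only [hw', elimWeight]
      ring
    have e : f z - V z = V (z.1, z.2 + 1) + V z * V (z.1, z.2 + 1) := by
      simp only [f]; abel
    rw [e]
    exact add_mem hV (M.mul_mem_left _ hV)
  have hsub : ∀ {j a}, a ∈ M.J j → WordRing.lift f a - a ∈ M.J (j + w x₀) :=
    fun ha => lift_sub_self_mem hf ha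
  let τ : MagnusRing p w' n →+* MagnusRing p w' n :=
    Ideal.Quotient.lift _ ((Ideal.Quotient.mk _).comp (WordRing.lift f)) fun a ha => by
      refine Ideal.Quotient.eq_zero_iff_mem.mpr ?_
      have := add_mem (M.anti (Nat.le_add_right _ _) (hsub ha)) ha
      rwa [sub_add_cancel] at this
  have hτ : ∀ j, ∀ a ∈ F.J j, τ a - a ∈ F.J (j + w x₀) := by
    rintro j _ ⟨b, hb, rfl⟩
    refine ⟨WordRing.lift f b - b, hsub hb, ?_⟩
    simp [τ]
  obtain ⟨T, hT, hTm⟩ := exists_unit_of_sub_mem (hw x₀) hF τ hτ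
  let u : ElimIndex x₀ → (MagnusRing p w' n)ˣ := fun z => magnusHom p hw1 n (FreeGroup.of z)
  have hu : ∀ z, (u z : MagnusRing p w' n) = 1 + Ideal.Quotient.mk _ (V z) := fun z => by
    simp [u, MagnusRing.var, V]
  have hτu : ∀ z, τ (u z) = u z * u (z.1, z.2 + 1) := by
    intro z
    have e : τ (Ideal.Quotient.mk _ (V z)) = Ideal.Quotient.mk _ (f z) := by
      simp [τ, V]
    rw [hu, hu, map_add, map_one, e]
    simp only [f, map_add, map_mul]
    noncomm_ring
  let L : (MagnusRing p w' n)ˣ →* (filteredEnd F)ˣ :=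
    Units.map (filteredLmul F : MagnusRing p w' n →* filteredEnd F)
  have hTL : ∀ z, T * L (u z) = L (u z) * L (u (z.1, z.2 + 1)) * T := by
    intro z
    refine Units.ext (Subtype.ext (LinearMap.ext fun a => ?_))
    change (T : filteredEnd F).1 (u z * a) =
      u z * (u (z.1, z.2 + 1) * (T : filteredEnd F).1 a)
    rw [hT, hT, map_mul, hτu, mul_assoc]
  let ρ : FreeGroup X →* (filteredEnd F)ˣ :=
    FreeGroup.lift fun x => if hx : x = x₀ then T else L (u (⟨x, hx⟩, 0))
  have hρ0 : ρ (FreeGroup.of x₀) = T := by simp [ρ]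
  have hρy : ∀ y : {y : X // y ≠ x₀}, ρ (FreeGroup.of y.1) = L (u (y, 0)) := fun y => by
    simp [ρ, y.2]
  have hρ : ∀ x, ρ (FreeGroup.of x) ∈ (endFiltration F).units (w x) := by
    intro x
    by_cases hx : x = x₀
    · subst hx; rw [hρ0]; exact hTm
    · rw [hρy ⟨x, hx⟩, PFiltration.mem_units]
      have e : ((L (u (⟨x, hx⟩, 0)) : (filteredEnd F)ˣ) : filteredEnd F) - 1 =
          filteredLmul F (Ideal.Quotient.mk _ (V (⟨x, hx⟩, 0))) := by
        have : ((L (u (⟨x, hx⟩, 0)) : (filteredEnd F)ˣ) : filteredEnd F) =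
          filteredLmul F (u (⟨x, hx⟩, 0)) := rfl
        rw [this, hu, map_add, map_one, add_sub_cancel_left]
      rw [e]
      refine filteredLmul_mem ?_
      have := MagnusRing.var_mem (p := p) (w := w') n (⟨x, hx⟩, 0)
      simp only [hw', elimWeight, zero_mul, add_zero] at this
      exact this
  have hcomm : ∀ (y : {y : X // y ≠ x₀}) (k : ℕ), iterComm T (L (u (y, 0))) k = L (u (y, k)) := by
    intro y k
    induction k with
    | zero => rfl
    | succ k ih =>
      rw [iterComm, ih, hTL, mul_inv_cancel_right, inv_mul_cancel_left]
  have key : ρ.comp (elimHom x₀) = L.comp (magnusHom p hw1 n) := by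
    refine FreeGroup.ext_hom _ _ fun z => ?_
    rw [MonoidHom.comp_apply, elimHom_of, map_iterComm, hρ0, hρy, hcomm]
    rfl
  have h1 : L (magnusHom p hw1 n h) ∈ (endFiltration F).units n := by
    have := hh _ (endFiltration F) ρ hρ
    rwa [← MonoidHom.comp_apply, key] at this
  rw [mem_dimSubgroup_iff_magnusHom_mem hw1 le_rfl]
  -- a left multiplication is recovered from its value at `1`
  have h2 : (magnusHom p hw1 n h : MagnusRing p w' n) * 1 - 1 ∈ F.J (n + 0) :=
    h1 0 1 (F.mem_zero 1)
  rwa [mul_one] at h2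

/-- The filtration of `ℤ[ε]` in which `ε` has degree `s`. -/
def dualFiltration (p s : ℕ) : PFiltration p (DualNumber ℤ) where
  J n :=
    { carrier := {a | (p : ℤ) ^ n ∣ a.fst ∧ (p : ℤ) ^ (n - s) ∣ a.snd}
      zero_mem' := by simp
      add_mem' := fun ha hb => ⟨dvd_add ha.1 hb.1, dvd_add ha.2 hb.2⟩
      neg_mem' := fun ha => ⟨(dvd_neg).mpr ha.1, (dvd_neg).mpr ha.2⟩ }
  zero_eq := top_le_iff.mp fun a _ => by constructor <;> simp
  anti i j h a ha := ⟨(pow_dvd_pow _ h).trans ha.1, (pow_dvd_pow _ (by omega)).trans ha.2⟩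
  mul_mem := by
    rintro i j a b ⟨ha, ha'⟩ ⟨hb, hb'⟩
    refine ⟨?_, ?_⟩
    · rw [TrivSqZeroExt.fst_mul, pow_add]
      exact mul_dvd_mul ha hb
    · rw [TrivSqZeroExt.snd_mul]
      refine dvd_add ?_ ?_
      · refine (pow_dvd_pow _ (show i + j - s ≤ i + (j - s) by omega)).trans ?_
        rw [pow_add]
        exact mul_dvd_mul ha hb'
      · refine (pow_dvd_pow _ (show i + j - s ≤ j + (i - s) by omega)).trans ?_
        rw [pow_add]
        exact (mul_dvd_mul hb ha').trans (by simp [mul_comm])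
  p_mem := by
    constructor
    · simp
    · simp

/-- The unit `1 + e ε` of `ℤ[ε]`, as a homomorphism in `e`. -/
def dualUnit : Multiplicative ℤ →* (DualNumber ℤ)ˣ :=
  MonoidHom.toHomUnits
    { toFun := fun e => 1 + TrivSqZeroExt.inr e.toAdd
      map_one' := by simp
      map_mul' := fun a b => by
        ext <;> simp [TrivSqZeroExt.fst_mul, TrivSqZeroExt.snd_mul]; ring }

lemma dualUnit_mem {s n : ℕ} {e : Multiplicative ℤ} :
    dualUnit e ∈ (dualFiltration p s).units n ↔ (p : ℤ) ^ (n - s) ∣ e.toAdd := by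
  have h : ((dualUnit e : (DualNumber ℤ)ˣ) : DualNumber ℤ) - 1 = TrivSqZeroExt.inr e.toAdd := by
    simp [dualUnit]
  rw [PFiltration.mem_units, h]
  change (_ ∧ _) ↔ _
  simp

open Classical in
/-- If `x₀ ^ e` times an element in the remaining generators lies in the `n`-th dimension
subgroup, then `e` is divisible by `p ^ (n - w x₀)`. -/
lemma pow_dvd_of_zpow_mul_elimHom_mem {n : ℕ} {e : ℤ} {h : FreeGroup (ElimIndex x₀)}
    (hm : FreeGroup.of x₀ ^ e * elimHom x₀ h ∈ dimSubgroup p w n) :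
    (p : ℤ) ^ (n - w x₀) ∣ e := by
  let σ : FreeGroup X →* Multiplicative ℤ :=
    FreeGroup.lift fun x => if x = x₀ then Multiplicative.ofAdd 1 else 1
  have hσ : σ.comp (elimHom x₀) = 1 := by
    refine FreeGroup.ext_hom _ _ fun z => ?_
    have h0 : σ (FreeGroup.of z.1.1) = 1 := by simp [σ, z.1.2]
    rw [MonoidHom.comp_apply, elimHom_of, map_iterComm, h0, MonoidHom.one_apply]
    induction z.2 with
    | zero => rfl
    | succ k ih => simp [iterComm, ih]
  have h1 := hm _ (dualFiltration p (w x₀)) (dualUnit.comp σ) fun x => by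
    rw [MonoidHom.comp_apply, dualUnit_mem]
    by_cases hx : x = x₀
    · simp [hx]
    · simp [σ, hx]
  have h2 : σ (elimHom x₀ h) = 1 := DFunLike.congr_fun hσ h
  rw [MonoidHom.comp_apply, dualUnit_mem, map_mul, h2, mul_one, map_zpow] at h1
  simpa [σ] using h1

/-- Modulo the `n`-th term of an N-series that respects the weights, the commutators
`[y, x₀, …, x₀]` generate a normal subgroup, and `x₀` generates the quotient by it. -/
lemma exists_eq_zpow_mul_elimHom_mul {S : ℕ → Subgroup (FreeGroup X)} (hS : IsNSeries S)
    (hSw : ∀ x, FreeGroup.of x ∈ S (w x)) (hw : ∀ x, 1 ≤ w x) (x₀ : X) (n : ℕ)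
    (g : FreeGroup X) :
    ∃ (e : ℤ) (h : FreeGroup (ElimIndex x₀)), ∃ t ∈ S n,
      g = FreeGroup.of x₀ ^ e * elimHom x₀ h * t := by
  classical
  have := hS.normal n
  set K : Subgroup (FreeGroup X) := (elimHom x₀).range ⊔ S n
  set x := FreeGroup.of x₀ with hx
  let c : {y : X // y ≠ x₀} → ℕ → FreeGroup X := fun y k => iterComm x (FreeGroup.of y.1) k
  have hc : ∀ y k, c y k ∈ K := fun y k =>
    Subgroup.mem_sup_left ⟨FreeGroup.of (y, k), elimHom_of x₀ (y, k)⟩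
  have hxc : ∀ y k, x * c y k * x⁻¹ ∈ K := fun y k => by
    rw [← iterComm_mul_succ]
    exact mul_mem (hc y k) (hc y (k + 1))
  -- conjugation by `x₀⁻¹` is treated by descending induction on `k`: for large `k` the commutator
  -- lies in `S n`
  have hxc' : ∀ y d k, n ≤ k + d → x⁻¹ * c y k * x ∈ K := by
    intro y d
    induction d with
    | zero =>
      intro k hk
      have h1 : c y k ∈ S n := by
        refine hS.anti ?_ (iterComm_mem hS (hSw x₀) (hSw y.1) k)
        have := Nat.le_mul_of_pos_right k (hw x₀)
        omega
      have h2 := (hS.normal n).conj_mem _ h1 x⁻¹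
      rw [inv_inv] at h2
      exact Subgroup.mem_sup_right h2
    | succ d ih =>
      intro k hk
      have e : x⁻¹ * c y k * x = c y k * (x⁻¹ * c y (k + 1) * x)⁻¹ := by
        have := iterComm_mul_succ x (FreeGroup.of y.1) k
        change c y k * c y (k + 1) = x * c y k * x⁻¹ at this
        have h3 : c y (k + 1) = (c y k)⁻¹ * (x * c y k * x⁻¹) := by rw [← this]; group
        rw [h3]; group
      rw [e]
      exact mul_mem (hc y k) (inv_mem (ih (k + 1) (by omega)))
  have hconj : ∀ a : FreeGroup X, (∀ z, a * elimHom x₀ (FreeGroup.of z) * a⁻¹ ∈ K) →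
      ∀ k ∈ K, a * k * a⁻¹ ∈ K := by
    intro a ha k hk
    have hle : K ≤ K.comap (MulAut.conj a).toMonoidHom := by
      refine sup_le ?_ fun t ht => Subgroup.mem_sup_right ((hS.normal n).conj_mem t ht a)
      rw [← Subgroup.map_le_iff_le_comap, MonoidHom.map_range, MonoidHom.range_eq_map,
        ← FreeGroup.closure_range_of, MonoidHom.map_closure, Subgroup.closure_le]
      rintro _ ⟨_, ⟨z, rfl⟩, rfl⟩
      exact ha z
    exact hle hk
  have hxK : ∀ k ∈ K, x * k * x⁻¹ ∈ K := hconj x fun z => by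
    rw [elimHom_of]; exact hxc z.1 z.2
  have hxK' : ∀ k ∈ K, x⁻¹ * k * x ∈ K := by
    have := hconj x⁻¹ fun z => by
      rw [elimHom_of, inv_inv]; exact hxc' z.1 n z.2 (by omega)
    simpa using this
  have hyK : ∀ y : X, y ≠ x₀ → FreeGroup.of y ∈ K := fun y hy => hc ⟨y, hy⟩ 0
  have hnorm : Subgroup.normalizer (K : Set (FreeGroup X)) = ⊤ := by
    rw [← top_le_iff, ← FreeGroup.closure_range_of, Subgroup.closure_le]
    rintro _ ⟨y, rfl⟩
    by_cases hy : y = x₀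
    · rw [hy]
      refine Subgroup.mem_normalizer_iff.mpr fun k => ⟨hxK k, fun hk => ?_⟩
      have := hxK' _ hk
      rwa [show x⁻¹ * (FreeGroup.of x₀ * k * (FreeGroup.of x₀)⁻¹) * x = k by
        rw [hx]; group] at this
    · exact Subgroup.le_normalizer (hyK y hy)
  have hKn : K.Normal := Subgroup.normalizer_eq_top_iff.mp hnorm
  have htop : Subgroup.zpowers x ⊔ K = ⊤ := by
    rw [← top_le_iff, ← FreeGroup.closure_range_of, Subgroup.closure_le]
    rintro _ ⟨y, rfl⟩
    by_cases hy : y = x₀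
    · rw [hy]; exact Subgroup.mem_sup_left (Subgroup.mem_zpowers _)
    · exact Subgroup.mem_sup_right (hyK y hy)
  have hg : g ∈ Subgroup.zpowers x ⊔ K := by rw [htop]; trivial
  obtain ⟨_, ⟨e, rfl⟩, k, hk, rfl⟩ := Subgroup.mem_sup_of_normal_right.mp hg
  obtain ⟨_, ⟨h, rfl⟩, t, ht, rfl⟩ := Subgroup.mem_sup_of_normal_right.mp hk
  exact ⟨e, h, t, ht, (mul_assoc _ _ _).symm⟩

lemma of_mem_comap_elimHom {S : ℕ → Subgroup (FreeGroup X)} (hS : IsNSeries S)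
    (hSw : ∀ x, FreeGroup.of x ∈ S (w x)) (z : ElimIndex x₀) :
    FreeGroup.of z ∈ (S (elimWeight x₀ w z)).comap (elimHom x₀) := by
  rw [Subgroup.mem_comap, elimHom_of]
  exact iterComm_mem hS (hSw x₀) (hSw z.1.1) z.2

/-- One step of the induction: the inclusion of the dimension subgroup in the product of powers
passes from the remaining generators to all generators. -/
lemma dimSubgroup_le_powerProduct_of_elim (hw : ∀ x, 1 ≤ w x) {n : ℕ} (hx₀ : w x₀ ≤ n)
    (ih : ∀ S : ℕ → Subgroup (FreeGroup (ElimIndex x₀)), IsNSeries S →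
      (∀ z, FreeGroup.of z ∈ S (elimWeight x₀ w z)) →
      dimSubgroup p (elimWeight x₀ w) n ≤ powerProduct p S n) (hp : p.Prime)
    {S : ℕ → Subgroup (FreeGroup X)} (hS : IsNSeries S)
    (hSw : ∀ x, FreeGroup.of x ∈ S (w x)) : dimSubgroup p w n ≤ powerProduct p S n := by
  -- intersecting with the dimension subgroups keeps the error terms under control
  let T : ℕ → Subgroup (FreeGroup X) := fun i => S i ⊓ dimSubgroup p w i
  have hT : IsNSeries T := hS.inf isNSeries_dimSubgroup
  have hTw : ∀ x, FreeGroup.of x ∈ T (w x) := fun x => ⟨hSw x, of_mem_dimSubgroup x⟩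
  have hTS : powerProduct p T n ≤ powerProduct p S n :=
    powerProduct_le fun i hi hin g hg => pow_mem_powerProduct hi hin hg.1
  have hTD : powerProduct p T n ≤ dimSubgroup p w n :=
    powerProduct_le_dimSubgroup hp n fun _ => inf_le_right
  have hn : 1 ≤ n := (hw x₀).trans hx₀
  intro g hg
  obtain ⟨e, h, t, ht, rfl⟩ := exists_eq_zpow_mul_elimHom_mul hT hTw hw x₀ n g
  have hg' := (Subgroup.mul_mem_cancel_right _ ht.2).mp hg
  obtain ⟨k, rfl⟩ := pow_dvd_of_zpow_mul_elimHom_mem hg'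
  have hx : FreeGroup.of x₀ ^ ((p : ℤ) ^ (n - w x₀) * k) ∈ powerProduct p T n := by
    rw [zpow_mul]
    exact_mod_cast zpow_mem (pow_mem_powerProduct (hw x₀) hx₀ (hTw x₀)) k
  have hh := mem_dimSubgroup_of_elimHom_mem hw ((Subgroup.mul_mem_cancel_left _ (hTD hx)).mp hg')
  have hle : powerProduct p (fun i => (T i).comap (elimHom x₀)) n ≤
      (powerProduct p T n).comap (elimHom x₀) :=
    powerProduct_le fun i hi hin a ha => by
      rw [Subgroup.mem_comap, map_pow]
      exact pow_mem_powerProduct hi hin ha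
  exact hTS (mul_mem (mul_mem hx (hle (ih _ (hT.comap _) (of_mem_comap_elimHom hT hTw) hh)))
    (le_powerProduct hn ht))

end Elimination

/-- Generators of least weight are eliminated one by one: this lowers the number of generators of
that weight, and once there are none the least weight grows, until all weights are at least `n`.
Here `d` bounds the difference of `n` and the least weight. -/
theorem dimSubgroup_le_powerProduct {p : ℕ} (hp : p.Prime) {n : ℕ} (hn : 1 ≤ n) (d : ℕ) :
    ∀ {X : Type} {w : X → ℕ}, (∀ x, 1 ≤ w x) → {x | w x < n}.Finite → (∀ x, n ≤ w x + d) →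
      ∀ {S : ℕ → Subgroup (FreeGroup X)}, IsNSeries S → (∀ x, FreeGroup.of x ∈ S (w x)) →
        dimSubgroup p w n ≤ powerProduct p S n := by
  induction d with
  | zero =>
    intro X w _ _ hwd S hS hSw
    have h : S n = ⊤ := by
      rw [← top_le_iff, ← FreeGroup.closure_range_of, Subgroup.closure_le]
      rintro _ ⟨x, rfl⟩
      exact hS.anti (hwd x) (hSw x)
    exact le_top.trans (h.ge.trans (le_powerProduct hn))
  | succ d ihd =>
    have key : ∀ (N : ℕ) {X : Type} {w : X → ℕ}, (∀ x, 1 ≤ w x) → {x | w x < n}.Finite →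
        (∀ x, n ≤ w x + (d + 1)) → {x | w x + (d + 1) = n}.ncard = N →
        ∀ {S : ℕ → Subgroup (FreeGroup X)}, IsNSeries S → (∀ x, FreeGroup.of x ∈ S (w x)) →
          dimSubgroup p w n ≤ powerProduct p S n := by
      intro N
      induction N with
      | zero =>
        intro X w hw hfin hwd hN S hS hSw
        have hfin' : {x | w x + (d + 1) = n}.Finite :=
          hfin.subset fun x (hx : w x + (d + 1) = n) => show w x < n by omega
        rw [Set.ncard_eq_zero hfin'] at hN
        refine ihd hw hfin (fun x => ?_) hS hSw
        have h1 : ¬ w x + (d + 1) = n := fun h => by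
          have : x ∈ {x | w x + (d + 1) = n} := h
          rw [hN] at this; exact this
        have := hwd x
        omega
      | succ N ihN =>
        intro X w hw hfin hwd hN S hS hSw
        obtain ⟨x₀, hx₀⟩ : {x | w x + (d + 1) = n}.Nonempty := by
          refine Set.nonempty_of_ncard_ne_zero ?_
          omega
        have hx₀' : w x₀ + (d + 1) = n := hx₀
        have hfin' : {x | w x + (d + 1) = n}.Finite :=
          hfin.subset fun x (hx : w x + (d + 1) = n) => show w x < n by omega
        refine dimSubgroup_le_powerProduct_of_elim (x₀ := x₀) hw (by omega) ?_ hp hS hSw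
        intro S' hS' hSw'
        refine ihN (one_le_elimWeight hw) ?_ ?_ ?_ hS' hSw'
        · have hf : ({y : {y : X // y ≠ x₀} | w y.1 < n} ×ˢ {k : ℕ | k < n}).Finite :=
            (hfin.preimage Subtype.val_injective.injOn).prod (Set.finite_lt_nat n)
          refine hf.subset fun z (hz : w z.1.1 + z.2 * w x₀ < n) => ⟨?_, ?_⟩
          · change w z.1.1 < n; omega
          · change z.2 < n
            have := Nat.le_mul_of_pos_right z.2 (hw x₀)
            omega
        · intro z
          have := hwd z.1.1
          simp only [elimWeight]
          omega
        · -- only the generators `(y, 0)` with `y` of least weight have least weight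
          have himg : (fun z : ElimIndex x₀ => z.1.1) ''
              {z | elimWeight x₀ w z + (d + 1) = n} = {x | w x + (d + 1) = n} \ {x₀} := by
            ext y
            constructor
            · rintro ⟨z, hz, rfl⟩
              have hz' : w z.1.1 + z.2 * w x₀ + (d + 1) = n := hz
              have := hwd z.1.1
              exact ⟨show w z.1.1 + (d + 1) = n by omega, z.1.2⟩
            · rintro ⟨hy, hy0⟩
              exact ⟨(⟨y, hy0⟩, 0), by simpa [elimWeight] using hy, rfl⟩
          have hinj : Set.InjOn (fun z : ElimIndex x₀ => z.1.1)
              {z | elimWeight x₀ w z + (d + 1) = n} := by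
            have h0 : ∀ z : ElimIndex x₀, elimWeight x₀ w z + (d + 1) = n → z.2 = 0 := by
              intro z hz
              have h1 := hwd z.1.1
              have h2 := Nat.le_mul_of_pos_right z.2 (hw x₀)
              simp only [elimWeight] at hz
              omega
            intro z hz z' hz' h
            exact Prod.ext (Subtype.ext h) ((h0 z hz).trans (h0 z' hz').symm)
          rw [← hinj.ncard_image, himg, Set.ncard_sdiff_singleton_of_mem hx₀, hN]
          omega
    intro X w hw hfin hwd S hS hSw
    exact key _ hw hfin hwd rfl hS hSw

/-- In a free group of finite rank the subgroups `λ_n` are the dimension subgroups. -/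
theorem lambdaSeries_eq_dimSubgroup {p : ℕ} (hp : p.Prime) {X : Type} [Finite X] {n : ℕ}
    (hn : 1 ≤ n) : lambdaSeries p (FreeGroup X) n = dimSubgroup p (fun _ : X => 1) n := by
  refine le_antisymm (lambdaSeries_le_dimSubgroup hp n) ?_
  exact dimSubgroup_le_powerProduct hp hn n (fun _ => le_rfl) (Set.toFinite _) (fun _ => by omega)
    (isNSeries_lowerGamma _) fun x => by
      change _ ∈ (⊤ : Subgroup (FreeGroup X))
      trivial

/-! ### Centralisers modulo the series -/

section Commutators

open scoped commutatorElement

open Classical in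
/-- If an element `a` commutes with all variables modulo degree `m + 1`, then its coefficients at
nonempty words are those of an element of degree `m`: if a word `u` does not end in the letter `j`,
then the coefficient of `a x_j - x_j a` at `x_j u` is minus the coefficient of `a` at `u`. -/
lemma pow_dvd_coeff_of_commute {p : ℕ} {X : Type} [Nontrivial X] {m : ℕ} {a : WordRing X}
    (ha : ∀ j, a * WordRing.var j - WordRing.var j * a ∈
      (magnusFiltration p (fun _ : X => 1)).J (m + 1)) {u : FreeMonoid X} (hu : u ≠ 1) :
    (p : ℤ) ^ (m - wordWeight (fun _ : X => 1) u) ∣ a.coeff u := by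
  obtain ⟨v, i, rfl⟩ : ∃ v i, u = v * FreeMonoid.of i := by
    rcases List.eq_nil_or_concat u.toList with h | ⟨l, i, h⟩
    · exact absurd (FreeMonoid.toList.injective h) hu
    · exact ⟨FreeMonoid.ofList l, i, FreeMonoid.toList.injective (by simpa using h)⟩
  obtain ⟨j, hj⟩ := exists_ne i
  have h := mem_magnusFiltration.mp (ha j) (FreeMonoid.of j * (v * FreeMonoid.of i))
  have h1 : (a * WordRing.var j).coeff (FreeMonoid.of j * (v * FreeMonoid.of i)) = 0 := by
    refine MonoidAlgebra.coeff_mul_single_of_forall_mul_ne _ _ fun d hd => hj ?_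
    have := congrArg FreeMonoid.toList hd
    rw [← mul_assoc] at this
    simp only [FreeMonoid.toList_mul, FreeMonoid.toList_of] at this
    simpa using (List.append_inj' this rfl).2
  have h2 : (WordRing.var j * a).coeff (FreeMonoid.of j * (v * FreeMonoid.of i)) =
      a.coeff (v * FreeMonoid.of i) := by
    rw [WordRing.var, MonoidAlgebra.coeff_single_mul_eq_mul_coeff (v * FreeMonoid.of i), one_mul]
    intro d _
    exact ⟨fun h => mul_left_cancel h, fun h => by rw [h]⟩
  rw [MonoidAlgebra.coeff_sub, Finsupp.sub_apply, h1, h2, zero_sub, dvd_neg, wordWeight_mul,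
    wordWeight_of] at h
  rwa [Nat.add_comm 1, Nat.add_sub_add_right] at h

/-- The constant coefficient of the Magnus representation is `1`. -/
lemma constant_coeff_of_magnusHom {p : ℕ} {X : Type} {w : X → ℕ} (hw : ∀ x, 1 ≤ w x) {n : ℕ}
    {g : FreeGroup X} {a : WordRing X}
    (ha : (magnusHom p hw n g : MagnusRing p w n) = Ideal.Quotient.mk _ a) :
    (p : ℤ) ^ n ∣ (a - 1).coeff 1 := by
  classical
  let ε : WordRing X →+* ZMod (p ^ n) := WordRing.lift fun _ => 0
  have hword : ∀ u : FreeMonoid X, u ≠ 1 →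
      FreeMonoid.lift (fun _ : X => (0 : ZMod (p ^ n))) u = 0 := by
    intro u
    induction u with
    | one => exact fun h => absurd rfl h
    | of x => simp
    | mul u v hu hv =>
      intro h
      rw [map_mul]
      by_cases h1 : u = 1
      · rw [hv fun h2 => h (by rw [h1, h2, one_mul]), mul_zero]
      · rw [hu h1, zero_mul]
  have hε : ∀ b : WordRing X, ε b = b.coeff 1 := by
    intro b
    induction b using MonoidAlgebra.induction_linear with
    | zero => simp
    | add b b' hb hb' => simp [hb, hb']
    | single u c =>
      simp only [ε, WordRing.lift_single]
      rw [MonoidAlgebra.coeff_single, Finsupp.single_apply]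
      split_ifs with h
      · simp [h]
      · simp [hword u h]
  have hdvd : ∀ b : WordRing X, ε b = 0 ↔ (p : ℤ) ^ n ∣ b.coeff 1 := by
    intro b
    rw [hε, ZMod.intCast_zmod_eq_zero_iff_dvd]
    push_cast
    rfl
  let θ : MagnusRing p w n →+* ZMod (p ^ n) := Ideal.Quotient.lift _ ε fun b hb =>
    (hdvd b).mpr (by simpa using hb 1)
  have hθ : (Units.map (θ : MagnusRing p w n →* ZMod (p ^ n))).comp (magnusHom p hw n) = 1 := by
    refine FreeGroup.ext_hom _ _ fun x => Units.ext ?_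
    simp [θ, MagnusRing.var, ε]
  have h := congrArg Units.val (DFunLike.congr_fun hθ g)
  simp only [MonoidHom.comp_apply, Units.coe_map, MonoidHom.one_apply, Units.val_one] at h
  rw [ha] at h
  have h' : ε a = 1 := h
  rw [← hdvd, map_sub, h', map_one, sub_self]

/-- For rank at least two, an element that is central modulo the dimension subgroup of degree
`m + 1` lies in the one of degree `m`. -/
lemma mem_dimSubgroup_of_commutator_mem {p : ℕ} {X : Type} [Nontrivial X] {m : ℕ}
    {g : FreeGroup X}
    (hg : ∀ y, ⁅g, FreeGroup.of y⁆ ∈ dimSubgroup p (fun _ : X => 1) (m + 1)) :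
    g ∈ dimSubgroup p (fun _ : X => 1) m := by
  have hw : ∀ _ : X, 1 ≤ 1 := fun _ => le_rfl
  set w : X → ℕ := fun _ => 1
  obtain ⟨a, ha⟩ := Ideal.Quotient.mk_surjective
    (magnusHom p hw (m + 1) g : MagnusRing p w (m + 1))
  have hcomm : ∀ j, a * WordRing.var j - WordRing.var j * a ∈
      (magnusFiltration p w).J (m + 1) := by
    intro j
    have h1 : magnusHom p hw (m + 1) ⁅g, FreeGroup.of j⁆ = 1 :=
      Units.ext (sub_eq_zero.mp (truncFiltration_eq_bot
        ((mem_dimSubgroup_iff_magnusHom_mem hw le_rfl).mp (hg j))))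
    rw [map_commutatorElement, commutatorElement_eq_one_iff_mul_comm] at h1
    have h2 := congrArg Units.val h1
    rw [Units.val_mul, Units.val_mul, magnusHom_of, ← ha, mul_add, add_mul, mul_one, one_mul,
      add_right_inj] at h2
    refine (Ideal.Quotient.mk_eq_mk_iff_sub_mem
      (I := (magnusFiltration p w).ideal (m + 1)) _ _).mp ?_
    rw [map_mul, map_mul]
    exact h2
  have hmem : a - 1 ∈ (magnusFiltration p w).J m := by
    intro u
    by_cases hu : u = 1
    · subst hu
      exact (pow_dvd_pow _ (by simp)).trans (constant_coeff_of_magnusHom hw ha.symm)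
    · have h1 : (1 : WordRing X).coeff u = 0 := by
        classical
        rw [MonoidAlgebra.one_def, MonoidAlgebra.coeff_single, Finsupp.single_apply,
          if_neg (Ne.symm hu)]
      rw [MonoidAlgebra.coeff_sub, Finsupp.sub_apply, h1, sub_zero]
      exact pow_dvd_coeff_of_commute hcomm hu
  rw [mem_dimSubgroup_iff_magnusHom_mem hw (Nat.le_succ m), PFiltration.mem_units, ← ha]
  exact ⟨a - 1, hmem, by simp⟩

/-! ### Quotients of the free group -/

lemma map_powerSubgroup {G H : Type*} [Group G] [Group H] (f : G →* H) (K : Subgroup G) (m : ℕ) :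
    (powerSubgroup K m).map f = powerSubgroup (K.map f) m := by
  rw [powerSubgroup, powerSubgroup, MonoidHom.map_closure]
  congr 1
  ext x
  constructor
  · rintro ⟨_, ⟨g, hg, rfl⟩, rfl⟩
    exact ⟨f g, ⟨g, hg, rfl⟩, (map_pow f g m).symm⟩
  · rintro ⟨_, ⟨g, hg, rfl⟩, rfl⟩
    exact ⟨g ^ m, ⟨g, hg, rfl⟩, map_pow f g m⟩

lemma map_lambdaSeries {G H : Type*} [Group G] [Group H] {f : G →* H}
    (hf : Function.Surjective f) (p n : ℕ) :
    (lambdaSeries p G n).map f = lambdaSeries p H n := by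
  simp only [lambdaSeries, Subgroup.map_iSup, map_powerSubgroup, lowerGamma,
    Subgroup.map_lowerCentralSeries, Subgroup.map_top_of_surjective f hf]

lemma lambdaSeries_le_lambdaSeries {p : ℕ} (hp : p.Prime) {X : Type} [Finite X]
    {m n : ℕ} (hm : 1 ≤ m) (hmn : m ≤ n) :
    lambdaSeries p (FreeGroup X) n ≤ lambdaSeries p (FreeGroup X) m := by
  rw [lambdaSeries_eq_dimSubgroup hp hm, lambdaSeries_eq_dimSubgroup hp (hm.trans hmn)]
  exact isNSeries_dimSubgroup.anti hmn

/-- The centre of `F` modulo `λ_{m+1}` is `λ_m`. -/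
lemma forall_commutator_mem_lambdaSeries_iff {p : ℕ} (hp : p.Prime) {X : Type} [Finite X]
    [Nontrivial X] {m : ℕ} (hm : 1 ≤ m) {g : FreeGroup X} :
    (∀ y, ⁅g, y⁆ ∈ lambdaSeries p (FreeGroup X) (m + 1)) ↔ g ∈ lambdaSeries p (FreeGroup X) m := by
  rw [lambdaSeries_eq_dimSubgroup hp hm, lambdaSeries_eq_dimSubgroup hp (Nat.le_add_left 1 m)]
  refine ⟨fun h => mem_dimSubgroup_of_commutator_mem fun y => h _, fun h y => ?_⟩
  have h1 : y ∈ dimSubgroup p (fun _ : X => 1) 1 := by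
    rw [← lambdaSeries_eq_dimSubgroup hp le_rfl, lambdaSeries_eq_powerProduct]
    exact le_powerProduct le_rfl (show y ∈ (⊤ : Subgroup (FreeGroup X)) from trivial)
  exact isNSeries_dimSubgroup.commutator_le m 1 (Subgroup.commutator_mem_commutator h h1)

/-- The `k`-th centre of `F / λ_{m+k}(F)` is the image of `λ_m(F)`. -/
lemma upperCentralSeries_quotient_lambdaSeries {p : ℕ} (hp : p.Prime) {X : Type} [Finite X]
    [Nontrivial X] (k : ℕ) {m : ℕ} (hm : 1 ≤ m) :
    Subgroup.upperCentralSeries (FreeGroup X ⧸ lambdaSeries p (FreeGroup X) (m + k)) k =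
      (lambdaSeries p (FreeGroup X) m).map (QuotientGroup.mk' _) := by
  set N := m + k with hN
  have key : ∀ k m, 1 ≤ m → m + k = N →
      Subgroup.upperCentralSeries (FreeGroup X ⧸ lambdaSeries p (FreeGroup X) N) k =
        (lambdaSeries p (FreeGroup X) m).map (QuotientGroup.mk' _) := by
    intro k
    induction k with
    | zero =>
      rintro m - rfl
      rw [Subgroup.upperCentralSeries_zero]
      exact (QuotientGroup.map_mk'_self _).symm
    | succ k ih =>
      intro m hm hmk
      have hle {i : ℕ} (h1 : 1 ≤ i) (h2 : i ≤ N) (g : FreeGroup X) :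
          (QuotientGroup.mk' (lambdaSeries p (FreeGroup X) N) g ∈
            (lambdaSeries p (FreeGroup X) i).map (QuotientGroup.mk' _)) ↔
          g ∈ lambdaSeries p (FreeGroup X) i := by
        rw [← Subgroup.mem_comap, QuotientGroup.comap_map_mk',
          sup_eq_right.mpr (lambdaSeries_le_lambdaSeries hp h1 h2)]
      ext x
      obtain ⟨g, rfl⟩ := QuotientGroup.mk'_surjective _ x
      rw [Subgroup.mem_upperCentralSeries_succ_iff, ih (m + 1) (by omega) (by omega),
        hle hm (by omega), ← forall_commutator_mem_lambdaSeries_iff hp hm,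
        (QuotientGroup.mk'_surjective _).forall]
      refine forall_congr' fun y => ?_
      rw [← hle (by omega) (by omega), map_commutatorElement, commutatorElement_def]
  exact key k m hm hN.symm

end Commutators

theorem mainTheorem5 (p d c : ℕ) (hp : p.Prime) (hd : 2 ≤ d) (hc : 1 ≤ c) (n : ℕ) :
    IsNCapable n (DispositionGroup p d c) ∧
    Subgroup.upperCentralSeries (DispositionGroup p d (n + c)) n =
      lambdaSeries p (DispositionGroup p d (n + c)) (c + 1) ∧
    Nonempty (DispositionGroup p d c ≃*
      DispositionGroup p d (n + c) ⧸
        Subgroup.upperCentralSeries (DispositionGroup p d (n + c)) n) := by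
  have : Nontrivial (Fin d) := Fin.nontrivial_iff_two_le.mpr hd
  have hN : n + c + 1 = (c + 1) + n := by omega
  have hZ : Subgroup.upperCentralSeries (DispositionGroup p d (n + c)) n =
      (lambdaSeries p (FreeGroup (Fin d)) (c + 1)).map
        (QuotientGroup.mk' (lambdaSeries p (FreeGroup (Fin d)) (n + c + 1))) := by
    have := upperCentralSeries_quotient_lambdaSeries hp (X := Fin d) n (Nat.le_add_left 1 c)
    rw [← hN] at this
    exact this
  have hle : lambdaSeries p (FreeGroup (Fin d)) (n + c + 1) ≤
      lambdaSeries p (FreeGroup (Fin d)) (c + 1) :=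
    lambdaSeries_le_lambdaSeries hp (by omega) (by omega)
  have e : Nonempty (DispositionGroup p d c ≃* DispositionGroup p d (n + c) ⧸
      Subgroup.upperCentralSeries (DispositionGroup p d (n + c)) n) :=
    ⟨((QuotientGroup.quotientMulEquivOfEq hZ).trans
      (QuotientGroup.quotientQuotientEquivQuotient _ _ hle)).symm⟩
  exact ⟨⟨_, _, e⟩, hZ.trans (map_lambdaSeries (QuotientGroup.mk'_surjective _) p (c + 1)), e⟩
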